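/- **Setting.** Let $m,d,n\ge 0$ be integers, $p>0$, and let $\sigma:\mathbb R\to\mathbb R$ be positively $p$-homogeneous: $\sigma(ct)=c^p\sigma(t)$ for all $c>0$, $t\in\mathbb R$. For $\theta=((a_1,w_1),\dots,(a_m,w_m))\in\Theta:=(\mathbb R\times\mathbb R^d)^m$ (with the Euclidean inner product) put $f_\theta(x)=\sum_{i=1}^m a_i\sigma(w_i^\top x)$, and for fixed $x_1,\dots,x_n\in\mathbb R^d$ put $\Phi_X(\theta)=(f_\theta(x_1),\dots,f_\theta(x_n))\in\mathbb R^n$. The group $G=S_m\ltimes(\mathbb R_{>0})^m$ acts on $\Theta$ by permuting the pairs $(a_i,w_i)$ and by the rescalings $(a_i,w_i)\mapsto(c_i^{-p}a_i,c_iw_i)$; write $$T_\theta(G\cdot\theta)=\{((-p\xi_1a_1,\xi_1w_1),\dots,(-p\xi_ma_m,\xi_mw_m)):\xi\in\mathbb R^m\}.$$ Let $\Theta_{\mathrm{reg}}\subset\Theta$ be an open $G$-invariant set on which $\Phi_X$ is $C^\infty$, the action of $G$ is proper and locally free (discrete isotropy groups), and $\ker D\Phi_X(\theta)=T_\theta(G\cdot\theta)$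 for every $\theta\in\Theta_{\mathrm{reg}}$. Let $\mathcal M_{\mathrm{reg}}=\Theta_{\mathrm{reg}}/G$ be the quotient manifold, with the smooth structure for which the quotient map $q:\Theta_{\mathrm{reg}}\to\mathcal M_{\mathrm{reg}}$ is a smooth submersion. For $\theta\in\Theta_{\mathrm{reg}}$ let $\mathcal V_\theta=T_\theta(G\cdot\theta)$, let $\mathcal H_\theta=\mathcal V_\theta^{\perp}$ be its Euclidean orthogonal complement, $P^{\mathrm{hor}}_\theta$ the orthogonal projection onto $\mathcal H_\theta$, and $$g_\theta(u,v)=\tfrac1n\langle D\Phi_X(\theta)[u],D\Phi_X(\theta)[v]\rangle_{\mathbb R^n}.$$ For $x\in\mathcal M_{\mathrm{reg}}$ and $\xi,\eta\in T_x\mathcal M_{\mathrm{reg}}$ put $\bar g_x(\xi,\eta)=g_\theta(P^{\mathrm{hor}}_\theta u,P^{\mathrm{hor}}_\theta v)$ for any $\theta$ with $q(\theta)=x$ and any $u,v$ with $Dq_\theta[u]=\xi$, $Dq_\theta[v]=\eta$. Let $\widetilde L:\mathbb R^n\to\mathbb R$ be $C^\infty$, $\mathcal L=\widetilde L\circ\Phi_X$,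 and let $\bar{\mathcal L}:\mathcal M_{\mathrm{reg}}\to\mathbb R$ be the descended loss, $\bar{\mathcal L}\circ q=\mathcal L$. **Theorem (Horizontal lift of quotient gradient flow).** The form $\bar g$ is well defined, with $\bar g_{q(\theta)}(Dq_\theta[u],Dq_\theta[v])=g_\theta(u,v)$ for all $\theta\in\Theta_{\mathrm{reg}}$, $u,v\in\mathcal H_\theta$. For every $x\in\mathcal M_{\mathrm{reg}}$ there is a unique $\operatorname{grad}_{\bar g}\bar{\mathcal L}(x)\in T_x\mathcal M_{\mathrm{reg}}$ with $\bar g_x(\operatorname{grad}_{\bar g}\bar{\mathcal L}(x),\xi)=D\bar{\mathcal L}_x[\xi]$ for all $\xi$. For every $\theta\in\Theta_{\mathrm{reg}}$ there is a unique $u_{\mathcal L}(\theta)\in\mathcal H_\theta$ with $$Dq_\theta[u_{\mathcal L}(\theta)]=\operatorname{grad}_{\bar g}\bar{\mathcal L}(q(\theta)),$$ and for $u\in\mathcal H_\theta$ this equation for $u$ is equivalent to $g_\theta(u,v)=D\mathcal L(\theta)[v]$ for all $v\in\mathcal H_\theta$. Moreover, for every $T\in(0,\infty]$: 1. Let $\gamma:[0,T)\to\mathcal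 M_{\mathrm{reg}}$ be a $C^1$ solution of $\dot\gamma_t=-\operatorname{grad}_{\bar g}\bar{\mathcal L}(\gamma_t)$, let $s:U\to\Theta_{\mathrm{reg}}$ be a smooth local section of $q$ (so $q\circ s=\mathrm{id}_U$) on an open set $U\subset\mathcal M_{\mathrm{reg}}$, and let $0<T_0<T$ with $\gamma([0,T_0])\subset U$. Then the lifted curve $\theta_t:=s(\gamma_t)$, $t\in[0,T_0]$, is $C^1$ and satisfies, for all $t\in[0,T_0]$, $$Dq_{\theta_t}[\dot\theta_t]=-\operatorname{grad}_{\bar g}\bar{\mathcal L}(\gamma_t),\qquad P^{\mathrm{hor}}_{\theta_t}\dot\theta_t=-u_{\mathcal L}(\theta_t).$$ 2. Conversely, if $\theta:[0,T)\to\Theta_{\mathrm{reg}}$ is a $C^1$ solution of $\dot\theta_t=-u_{\mathcal L}(\theta_t)$, then $\gamma_t:=q(\theta_t)$ is a $C^1$ solution of $\dot\gamma_t=-\operatorname{grad}_{\bar g}\bar{\mathcal L}(\gamma_t)$ on $[0,T)$. -/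

import Mathlib

open scoped Manifold ContDiff Topology

noncomputable section

namespace ShallowNet

theorem exists_smooth_local_inverse {E : Type*} [NormedAddCommGroup E] [NormedSpace ℝ E]
    [CompleteSpace E] (A : E → E) (O : Set E) (hO : IsOpen O) (h0 : (0 : E) ∈ O)
    (hA : ContDiffOn ℝ ∞ A O) (hd : HasFDerivAt A (ContinuousLinearMap.id ℝ E) 0) :
    ∃ K : OpenPartialHomeomorph E E, (0 : E) ∈ K.source ∧ K.source ⊆ O ∧ (∀ y, K y = A y) ∧
      ContDiffOn ℝ ∞ K.symm K.target := by
  have hA0 : ContDiffAt ℝ ∞ A 0 := hA.contDiffAt (hO.mem_nhds h0)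
  let K₀ := hA0.toOpenPartialHomeomorph A (f' := ContinuousLinearEquiv.refl ℝ E) hd (by simp)
  have hcont : ContinuousOn (fderiv ℝ A) O := hA.continuousOn_fderiv_of_isOpen hO (by simp)
  let N : Set (E →L[ℝ] E) := Set.range ((↑) : (E ≃L[ℝ] E) → E →L[ℝ] E)
  have hN : IsOpen N := ContinuousLinearEquiv.isOpen
  have hU : IsOpen (O ∩ fderiv ℝ A ⁻¹' N) := hcont.isOpen_inter_preimage hO hN
  let K := K₀.restrOpen _ hU
  refine ⟨K, ⟨hA0.mem_toOpenPartialHomeomorph_source _ _, h0,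
    ⟨ContinuousLinearEquiv.refl ℝ E, hd.fderiv.symm⟩⟩, fun y hy => hy.2.1, fun y => rfl, ?_⟩
  intro z hz
  have hs : K.symm z ∈ K.source := K.map_target hz
  obtain ⟨L, hL⟩ := hs.2.2
  have hAz : ContDiffAt ℝ ∞ A (K.symm z) := hA.contDiffAt (hO.mem_nhds hs.2.1)
  refine (K.contDiffAt_symm (f₀' := L) hz ?_ hAz).contDiffWithinAt
  rw [hL]
  exact (hAz.differentiableAt (by simp)).hasFDerivAt


/-- The parameter space `(ℝ × ℝ^d)^m` with its Euclidean inner product. The coordinate `(i, none)` is the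
output coefficient `a_i`, the coordinates `(i, some j)` are those of the hidden weight `w_i`. -/
abbrev Param (m d : ℕ) : Type := EuclideanSpace ℝ (Fin m × Option (Fin d))

namespace Param

variable {m d : ℕ}

/-- The output coefficient of the `i`-th hidden unit. -/
def a (θ : Param m d) (i : Fin m) : ℝ := θ (i, none)

/-- The weight vector of the `i`-th hidden unit. -/
def w (θ : Param m d) (i : Fin m) : EuclideanSpace ℝ (Fin d) :=
  WithLp.toLp 2 fun j => θ (i, some j)

/-- The parameter with the given output coefficients and hidden weights. -/
def mk (a : Fin m → ℝ) (w : Fin m → EuclideanSpace ℝ (Fin d)) : Param m d :=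
  WithLp.toLp 2 fun k => k.2.elim (a k.1) fun j => w k.1 j

@[simp] theorem a_mk (a : Fin m → ℝ) (w : Fin m → EuclideanSpace ℝ (Fin d)) :
    Param.a (mk a w) = a := rfl

@[simp] theorem w_mk (a : Fin m → ℝ) (w : Fin m → EuclideanSpace ℝ (Fin d)) :
    Param.w (mk a w) = w := rfl

theorem ext_units {θ η : Param m d} (ha : ∀ i, Param.a θ i = Param.a η i)
    (hw : ∀ i, Param.w θ i = Param.w η i) : θ = η := by
  ext ⟨i, _ | j⟩
  · exact ha i
  · exact congrArg (fun v : EuclideanSpace ℝ (Fin d) => v j) (hw i)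

end Param

/-- The data of a shallow network of width `m` on `ℝ^d` with a sample of size `n`: a positively
`p`-homogeneous activation `σ`, with `p > 0`, and the sample points `X`. -/
structure Model (m d n : ℕ) where
  /-- the activation function -/
  σ : ℝ → ℝ
  /-- the degree of homogeneity -/
  p : ℝ
  p_pos : 0 < p
  homog : ∀ c t : ℝ, 0 < c → σ (c * t) = c ^ p * σ t
  /-- the sample -/
  X : Fin n → EuclideanSpace ℝ (Fin d)

/-- The symmetry group, the semidirect product of `(ℝ_{>0})^m` with the permutations of the `m` hidden
units, which act on `(ℝ_{>0})^m` by permuting the coordinates. -/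
abbrev SymGroup (m : ℕ) : Type :=
  (Fin m → {c : ℝ // 0 < c}) ⋊[mulAutArrow] (Equiv.Perm (Fin m))

/-- The product topology, in which the finite group of permutations is discrete. -/
instance (m : ℕ) : TopologicalSpace (SymGroup m) :=
  TopologicalSpace.induced
    (fun g => (g.left, (g.right : Fin m → Fin m))) inferInstance

namespace Model

variable {m d n : ℕ} (S : Model m d n)

/-- The network function `f_θ(x) = ∑ i, a_i σ(w_i ⬝ x)`. -/
def net (θ : Param m d) (x : EuclideanSpace ℝ (Fin d)) : ℝ :=
  ∑ i, Param.a θ i * S.σ (inner ℝ (Param.w θ i) x)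

/-- The finite-sample realization map `Φ_X(θ) = (f_θ(x_1), …, f_θ(x_n))`. -/
def pred (θ : Param m d) : EuclideanSpace ℝ (Fin n) :=
  WithLp.toLp 2 fun k => S.net θ (S.X k)

/-- The action of the symmetry group: `(c, π)` relabels the hidden units by `π` and replaces
`(a_i, w_i)` by `(c_i ^ (-p) a_i, c_i w_i)`. -/
def act (g : SymGroup m) (θ : Param m d) : Param m d :=
  Param.mk (fun i => (g.left i : ℝ) ^ (-S.p) * Param.a θ (g.right.symm i))
    fun i => (g.left i : ℝ) • Param.w θ (g.right.symm i)

theorem act_one (θ : Param m d) : S.act 1 θ = θ := by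
  refine Param.ext_units (fun i => ?_) (fun i => ?_) <;> simp [act, Equiv.Perm.one_def]

theorem act_mul (g h : SymGroup m) (θ : Param m d) :
    S.act (g * h) θ = S.act g (S.act h θ) := by
  refine Param.ext_units (fun i => ?_) (fun i => ?_)
  · have := Real.mul_rpow (g.left i).2.le (h.left (g.right.symm i)).2.le (z := -S.p)
    change ((g.left i : ℝ) * (h.left (g.right.symm i) : ℝ)) ^ (-S.p) * _ =
      (g.left i : ℝ) ^ (-S.p) * ((h.left (g.right.symm i) : ℝ) ^ (-S.p) * _)
    rw [this, mul_assoc]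
    rfl
  · change ((g.left i : ℝ) * (h.left (g.right.symm i) : ℝ)) •
      Param.w θ (h.right.symm (g.right.symm i)) = (g.left i : ℝ) •
        ((h.left (g.right.symm i) : ℝ) • Param.w θ (h.right.symm (g.right.symm i)))
    rw [mul_smul]

theorem continuous_act (g : SymGroup m) : Continuous (S.act g) := by
  refine (PiLp.continuous_toLp 2 _).comp (continuous_pi ?_)
  rintro ⟨i, _ | j⟩
  · simp only [Option.elim, Param.a]; fun_prop
  · simp only [Option.elim, Param.w, PiLp.smul_apply]; fun_prop

theorem pred_act (g : SymGroup m) (θ : Param m d) : S.pred (S.act g θ) = S.pred θ := by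
  ext k
  simp only [pred, net]
  rw [← Equiv.sum_comp g.right]
  refine Finset.sum_congr rfl fun i _ => ?_
  have hc := (g.left (g.right i)).2
  simp [act, inner_smul_left, S.homog _ _ hc]
  rw [Real.rpow_neg hc.le]
  field_simp

/-- The infinitesimal action: the derivative at `t = 0` of
`((exp (-p t ξ_i) a_i, exp (t ξ_i) w_i))_i`. -/
def orbitVec (θ : Param m d) : (Fin m → ℝ) →ₗ[ℝ] Param m d where
  toFun ξ := Param.mk (fun i => -S.p * ξ i * Param.a θ i) fun i => ξ i • Param.w θ i
  map_add' ξ η := by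
    ext ⟨i, _ | j⟩ <;> simp [Param.mk] <;> ring
  map_smul' c ξ := by
    ext ⟨i, _ | j⟩ <;> simp [Param.mk] <;> ring

/-- The tangent space `T_θ(G ⬝ θ)` of the orbit through `θ`. -/
def orbitTangent (θ : Param m d) : Submodule ℝ (Param m d) := LinearMap.range (S.orbitVec θ)

/-- The action is locally free at `θ`: the isotropy group of `θ` is discrete. -/
def LocallyFreeAt (θ : Param m d) : Prop :=
  DiscreteTopology {g : SymGroup m // S.act g θ = θ}

/-- The regular parameter space `Θ_reg`: an open subset of `Θ`, invariant under the symmetry group, on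
which `Φ_X` is smooth, the action is locally free, and the kernel of `DΦ_X(θ)` is the tangent space of
the orbit through `θ`. -/
structure RegularDomain where
  /-- the underlying open set -/
  carrier : TopologicalSpace.Opens (Param m d)
  invariant : ∀ (g : SymGroup m) (θ : Param m d), θ ∈ carrier → S.act g θ ∈ carrier
  smooth : ContDiffOn ℝ ∞ S.pred carrier
  locallyFree : ∀ θ ∈ carrier, S.LocallyFreeAt θ
  ker_eq : ∀ θ ∈ carrier, LinearMap.ker (fderiv ℝ S.pred θ).toLinearMap = S.orbitTangent θ

theorem orbitVec_injective {θ : Param m d} (h : S.LocallyFreeAt θ) :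
    Function.Injective (S.orbitVec θ) := by
  rw [← LinearMap.ker_eq_bot, LinearMap.ker_eq_bot']
  intro ξ hξ
  by_contra hne
  obtain ⟨i, hi⟩ := Function.ne_iff.1 hne
  have ha : Param.a θ i = 0 := by
    have := congrArg (fun η => Param.a η i) hξ
    simpa [orbitVec, S.p_pos.ne', show ξ i ≠ 0 from hi, show Param.a (0 : Param m d) i = 0 from rfl]
      using this
  have hw : Param.w θ i = 0 := by
    have := congrArg (fun η => Param.w η i) hξ
    simpa [orbitVec, show ξ i ≠ 0 from hi, show Param.w (0 : Param m d) i = 0 from rfl] using this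
  let G : {c : ℝ // 0 < c} → SymGroup m := fun c => ⟨Function.update 1 i c, 1⟩
  have hG : ∀ c, S.act (G c) θ = θ := by
    intro c
    refine Param.ext_units (fun k => ?_) (fun k => ?_)
    · by_cases hk : k = i
      · subst hk; simp [act, G, ha, Equiv.Perm.one_def]
      · simp [act, G, Function.update_of_ne hk, Equiv.Perm.one_def]
    · by_cases hk : k = i
      · subst hk; simp [act, G, hw, Equiv.Perm.one_def]
      · simp [act, G, Function.update_of_ne hk, Equiv.Perm.one_def]
  have hGc : Continuous G := by
    rw [continuous_induced_rng]
    refine Continuous.prodMk ?_ continuous_const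
    exact continuous_const.update i continuous_id
  have : PreconnectedSpace {c : ℝ // 0 < c} :=
    isPreconnected_iff_preconnectedSpace.1 (isPreconnected_Ioi (a := (0 : ℝ)))
  have hdisc : DiscreteTopology {g : SymGroup m // S.act g θ = θ} := h
  have := PreconnectedSpace.constant (Y := {g : SymGroup m // S.act g θ = θ}) this
    (f := fun c => ⟨G c, hG c⟩) (hGc.subtype_mk hG) (x := ⟨1, one_pos⟩) (y := ⟨2, two_pos⟩)
  have := congrArg (fun g => ((g.1.left i : {c : ℝ // 0 < c}) : ℝ)) this
  simp [G] at this

namespace RegularDomain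

variable {S} (R : S.RegularDomain)

instance : MulAction (SymGroup m) R.carrier where
  smul g θ := ⟨S.act g θ, R.invariant g θ θ.2⟩
  one_smul θ := Subtype.ext (S.act_one θ)
  mul_smul g h θ := Subtype.ext (S.act_mul g h θ)

theorem coe_smul (g : SymGroup m) (θ : R.carrier) : ((g • θ : R.carrier) : Param m d) = S.act g θ :=
  rfl

instance : ContinuousConstSMul (SymGroup m) R.carrier where
  continuous_const_smul g :=
    ((S.continuous_act g).comp continuous_subtype_val).subtype_mk _

/-- The quotient `M_reg = Θ_reg / G`. -/
def MReg : Type := MulAction.orbitRel.Quotient (SymGroup m) R.carrier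

instance : TopologicalSpace R.MReg :=
  inferInstanceAs (TopologicalSpace (Quotient (MulAction.orbitRel (SymGroup m) R.carrier)))

instance [ProperSMul (SymGroup m) R.carrier] : T2Space R.MReg :=
  inferInstanceAs (T2Space (Quotient (MulAction.orbitRel (SymGroup m) R.carrier)))

/-- The quotient map `q : Θ_reg → M_reg`. -/
def q (θ : R.carrier) : R.MReg := Quotient.mk (MulAction.orbitRel (SymGroup m) R.carrier) θ

theorem isOpenQuotientMap_q : IsOpenQuotientMap R.q :=
  MulAction.isOpenQuotientMap_quotientMk

instance : SecondCountableTopology R.MReg :=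
  R.isOpenQuotientMap_q.isQuotientMap.secondCountableTopology R.isOpenQuotientMap_q.isOpenMap

theorem q_smul (g : SymGroup m) (θ : R.carrier) : R.q (g • θ) = R.q θ :=
  Quotient.sound (MulAction.mem_orbit θ g)

/-- The map induced by `Φ_X` on the quotient. -/
def predBar : R.MReg → EuclideanSpace ℝ (Fin n) :=
  Quotient.lift (fun θ : R.carrier => S.pred θ) (by
    rintro a b ⟨g, rfl⟩
    exact S.pred_act g b)

@[simp] theorem predBar_q (θ : R.carrier) : R.predBar (R.q θ) = S.pred θ := rfl

theorem continuous_predBar : Continuous R.predBar :=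
  R.isOpenQuotientMap_q.isQuotientMap.continuous_iff.2
    (R.smooth.continuousOn.comp_continuous continuous_subtype_val (fun θ => θ.2))

/-- A slice chart of the quotient: its inverse is `y ↦ q (s y)` for a smooth map `s` into `Θ_reg`, and
the chart itself is a linear function of the predictions. -/
structure IsSliceChart (e : OpenPartialHomeomorph R.MReg (EuclideanSpace ℝ (Fin (m * d))))
    (l : EuclideanSpace ℝ (Fin n) →L[ℝ] EuclideanSpace ℝ (Fin (m * d)))
    (s : EuclideanSpace ℝ (Fin (m * d)) → Param m d) : Prop where
  apply_eq : ∀ x ∈ e.source, e x = l (R.predBar x)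
  contDiffOn : ContDiffOn ℝ ∞ s e.target
  mem : ∀ y ∈ e.target, s y ∈ R.carrier
  symm_eq : ∀ y (hy : y ∈ e.target), e.symm y = R.q ⟨s y, mem y hy⟩

theorem finrank_param (m d : ℕ) : Module.finrank ℝ (Param m d) = m * d + m := by
  simp
  ring

theorem finrank_orbitTangent {θ : Param m d} (h : S.LocallyFreeAt θ) :
    Module.finrank ℝ (S.orbitTangent θ) = m := by
  rw [orbitTangent, LinearMap.finrank_range_of_inj (S.orbitVec_injective h)]
  simp

theorem finrank_orbitTangent_orthogonal {θ : Param m d} (h : S.LocallyFreeAt θ) :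
    Module.finrank ℝ (S.orbitTangent θ)ᗮ = m * d := by
  have h₁ := Submodule.finrank_add_finrank_orthogonal (S.orbitTangent θ)
  rw [finrank_orbitTangent h, finrank_param] at h₁
  omega

/-- The action of the exponential of `ξ`, an element of the Lie algebra of `(ℝ_{>0})^m`. -/
def flow (S : Model m d n) (ξ : Fin m → ℝ) (θ : Param m d) : Param m d :=
  Param.mk (fun i => Real.exp (-S.p * ξ i) * Param.a θ i) fun i => Real.exp (ξ i) • Param.w θ i

theorem flow_eq_act (ξ : Fin m → ℝ) (θ : Param m d) :
    flow S ξ θ = S.act ⟨fun i => ⟨Real.exp (ξ i), Real.exp_pos _⟩, 1⟩ θ := by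
  refine Param.ext_units (fun i => ?_) (fun i => ?_)
  · simp [act, flow, Equiv.Perm.one_def, ← Real.exp_mul, mul_comm]
  · simp [act, flow, Equiv.Perm.one_def]

theorem hasStrictFDerivAt_flow {F : Type*} [NormedAddCommGroup F] [NormedSpace ℝ F]
    (S : Model m d n) (θ : Param m d) (j : F →L[ℝ] Param m d) :
    HasStrictFDerivAt (fun z : (Fin m → ℝ) × F => flow S z.1 (θ + j z.2))
      ((LinearMap.toContinuousLinearMap (S.orbitVec θ)).coprod j) 0 := by
  rw [hasStrictFDerivAt_piLp]
  have hξ (i) : HasStrictFDerivAt (fun z : (Fin m → ℝ) × F => z.1 i)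
      ((ContinuousLinearMap.proj i).comp (ContinuousLinearMap.fst ℝ (Fin m → ℝ) F)) 0 :=
    ((ContinuousLinearMap.proj i).comp
      (ContinuousLinearMap.fst ℝ (Fin m → ℝ) F)).hasStrictFDerivAt
  have hj : HasStrictFDerivAt (fun z : (Fin m → ℝ) × F => θ + j z.2)
      (j.comp (ContinuousLinearMap.snd ℝ (Fin m → ℝ) F)) 0 :=
    ((j.comp (ContinuousLinearMap.snd ℝ (Fin m → ℝ) F)).hasStrictFDerivAt).const_add θ
  rintro ⟨i, _ | k⟩
  · refine ((((hξ i).const_mul (-S.p)).exp).mul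
      ((hasStrictFDerivAt_piLp 2).1 hj (i, none))).congr_fderiv ?_
    ext z <;> simp [orbitVec, Param.mk, Param.a]; ring
  · refine (((hξ i).exp).mul
      ((hasStrictFDerivAt_piLp 2).1 hj (i, some k))).congr_fderiv ?_
    ext z <;> simp [orbitVec, Param.mk, Param.w]; ring

theorem exists_isSliceChart (θ₀ : R.carrier) :
    ∃ e l s, R.IsSliceChart e l s ∧ R.q θ₀ ∈ e.source ∧ s (e (R.q θ₀)) = θ₀ := by
  have hlf := R.locallyFree θ₀ θ₀.2
  have hcd : ContDiffAt ℝ ∞ S.pred θ₀ := R.smooth.contDiffAt (R.carrier.isOpen.mem_nhds θ₀.2)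
  let H := (S.orbitTangent (θ₀ : Param m d))ᗮ
  have hfr : Module.finrank ℝ (EuclideanSpace ℝ (Fin (m * d))) = Module.finrank ℝ H := by
    rw [finrank_orbitTangent_orthogonal hlf]; simp
  let ι : EuclideanSpace ℝ (Fin (m * d)) ≃L[ℝ] H := ContinuousLinearEquiv.ofFinrankEq hfr
  let j : EuclideanSpace ℝ (Fin (m * d)) →L[ℝ] Param m d :=
    H.subtypeL.comp (ι : EuclideanSpace ℝ (Fin (m * d)) →L[ℝ] H)
  have hjH : ∀ y, j y ∈ H := fun y => (ι y).2
  have hjinj : Function.Injective j := H.injective_subtype.comp ι.injective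
  -- a linear left inverse of the derivative of the predictions along the slice
  obtain ⟨l, hl⟩ : ∃ l : EuclideanSpace ℝ (Fin n) →L[ℝ] EuclideanSpace ℝ (Fin (m * d)),
      l.comp ((fderiv ℝ S.pred θ₀).comp j) = ContinuousLinearMap.id ℝ _ := by
    have hker : LinearMap.ker ((fderiv ℝ S.pred θ₀).comp j).toLinearMap = ⊥ := by
      rw [LinearMap.ker_eq_bot']
      intro y hy
      have h₁ : j y ∈ S.orbitTangent (θ₀ : Param m d) := by
        rw [← R.ker_eq θ₀ θ₀.2]; exact hy
      have h₂ : j y = 0 := by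
        have := (Submodule.mem_orthogonal _ _).1 (hjH y) (j y) h₁
        exact inner_self_eq_zero.1 this
      exact hjinj (h₂.trans (map_zero j).symm)
    obtain ⟨l, hl⟩ := LinearMap.exists_leftInverse_of_injective _ hker
    refine ⟨LinearMap.toContinuousLinearMap l, ?_⟩
    ext1 y
    exact congrArg (fun f => f y) hl
  have hcont : Continuous fun y => (θ₀ : Param m d) + j y := by fun_prop
  let O : Set (EuclideanSpace ℝ (Fin (m * d))) := (fun y => (θ₀ : Param m d) + j y) ⁻¹' R.carrier
  have hO : IsOpen O := R.carrier.isOpen.preimage hcont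
  have h0O : (0 : EuclideanSpace ℝ (Fin (m * d))) ∈ O := by simp [O]
  -- the group flow together with the slice is a local diffeomorphism
  have hF := hasStrictFDerivAt_flow S (θ₀ : Param m d) j
  obtain ⟨D, hD⟩ : ∃ D : ((Fin m → ℝ) × EuclideanSpace ℝ (Fin (m * d))) ≃L[ℝ] Param m d,
      (D : _ →L[ℝ] Param m d) =
        (LinearMap.toContinuousLinearMap (S.orbitVec (θ₀ : Param m d))).coprod j := by
    have hinj : Function.Injective
        ((LinearMap.toContinuousLinearMap (S.orbitVec (θ₀ : Param m d))).coprod j) := by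
      rw [injective_iff_map_eq_zero]
      rintro ⟨ξ, y⟩ h
      have h' : S.orbitVec θ₀ ξ + j y = 0 := h
      have h₁ : inner ℝ (S.orbitVec θ₀ ξ) (j y) = 0 :=
        (Submodule.mem_orthogonal _ _).1 (hjH y) _ ⟨ξ, rfl⟩
      have h₂ : j y = 0 := by
        have : S.orbitVec θ₀ ξ = - j y := eq_neg_of_add_eq_zero_left h'
        rw [this, inner_neg_left, neg_eq_zero] at h₁
        exact inner_self_eq_zero.1 h₁
      have h₃ : S.orbitVec θ₀ ξ = 0 := by simpa [h₂] using h'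
      exact Prod.ext (S.orbitVec_injective hlf (h₃.trans (map_zero _).symm))
        (hjinj (h₂.trans (map_zero j).symm))
    have hfr' : Module.finrank ℝ ((Fin m → ℝ) × EuclideanSpace ℝ (Fin (m * d))) =
        Module.finrank ℝ (Param m d) := by
      rw [finrank_param, Module.finrank_prod]; simp; ring
    exact ⟨(LinearEquiv.ofInjectiveOfFinrankEq _ hinj hfr').toContinuousLinearEquiv, by ext <;> rfl⟩
  rw [← hD] at hF
  let FK := hF.toOpenPartialHomeomorph _
  obtain ⟨A₀, W₀, hA₀, h0A, hW₀, h0W, hAW⟩ := mem_nhds_prod_iff'.1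
    (show FK.source ∈ 𝓝 ((0 : Fin m → ℝ), (0 : EuclideanSpace ℝ (Fin (m * d)))) from
      FK.open_source.mem_nhds hF.mem_toOpenPartialHomeomorph_source)
  -- the predictions, read linearly, are coordinates along the slice
  have hA : ContDiffOn ℝ ∞ (fun y => l (S.pred ((θ₀ : Param m d) + j y))) (O ∩ W₀) := by
    have hj : ContDiffOn ℝ ∞ (fun y => (θ₀ : Param m d) + j y) (O ∩ W₀) :=
      (contDiff_const.add j.contDiff).contDiffOn
    have := ContDiffOn.comp (g := S.pred) (t := R.carrier) R.smooth hj fun y hy => hy.1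
    exact l.contDiff.comp_contDiffOn this
  have hAd : HasFDerivAt (fun y => l (S.pred ((θ₀ : Param m d) + j y)))
      (ContinuousLinearMap.id ℝ _) 0 := by
    rw [← hl]
    have hj : HasFDerivAt (fun y => (θ₀ : Param m d) + j y) j 0 := j.hasFDerivAt.const_add _
    have hp : HasFDerivAt S.pred (fderiv ℝ S.pred θ₀) ((θ₀ : Param m d) + j 0) := by
      rw [map_zero, add_zero]
      exact (hcd.differentiableAt (by simp)).hasFDerivAt
    exact l.hasFDerivAt.comp 0 (HasFDerivAt.comp (f := fun y => (θ₀ : Param m d) + j y) 0 hp hj)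
  obtain ⟨K, h0K, hKsub, hKA, hKs⟩ := exists_smooth_local_inverse _ (O ∩ W₀) (hO.inter hW₀)
    ⟨h0O, h0W⟩ hA hAd
  classical
  let qe : Param m d → R.MReg := fun θ => if h : θ ∈ R.carrier then R.q ⟨θ, h⟩ else R.q θ₀
  have hqe : ∀ θ (h : θ ∈ R.carrier), qe θ = R.q ⟨θ, h⟩ := fun θ h => dif_pos h
  have hqec : ContinuousOn qe R.carrier := by
    rw [continuousOn_iff_continuous_domRestrict]
    exact R.isOpenQuotientMap_q.continuous.congr fun θ => (hqe θ θ.2).symm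
  have hlq : ∀ y ∈ K.source, l (R.predBar (qe ((θ₀ : Param m d) + j y))) = K y := by
    intro y hy
    rw [hqe _ (hKsub hy).1, predBar_q, hKA]
  let e : OpenPartialHomeomorph R.MReg (EuclideanSpace ℝ (Fin (m * d))) :=
    { toFun := fun x => l (R.predBar x)
      invFun := fun y => qe ((θ₀ : Param m d) + j (K.symm y))
      source := (fun y => qe ((θ₀ : Param m d) + j y)) '' K.source
      target := K.target
      map_source' := by
        rintro _ ⟨y, hy, rfl⟩
        simp only [hlq y hy]
        exact K.map_source hy
      map_target' := fun y hy => ⟨K.symm y, K.map_target hy, rfl⟩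
      left_inv' := by
        rintro _ ⟨y, hy, rfl⟩
        simp only [hlq y hy, K.left_inv hy]
      right_inv' := by
        intro y hy
        simp only [hlq _ (K.map_target hy), K.right_inv hy]
      open_source := by
        have h₁ : IsOpen (FK '' (A₀ ×ˢ K.source)) :=
          FK.isOpen_image_of_subset_source (hA₀.prod K.open_source)
            ((Set.prod_mono_right fun y hy => (hKsub hy).2).trans hAW)
        have h₂ := R.isOpenQuotientMap_q.isOpenMap _ (h₁.preimage continuous_subtype_val)
        convert h₂ using 1
        ext x
        constructor
        · rintro ⟨y, hy, rfl⟩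
          refine ⟨⟨(θ₀ : Param m d) + j y, (hKsub hy).1⟩, ⟨(0, y), ⟨h0A, hy⟩, ?_⟩,
            (hqe _ (hKsub hy).1).symm⟩
          change flow S 0 _ = _
          rw [flow_eq_act]
          convert S.act_one _ using 2
          refine SemidirectProduct.ext ?_ rfl
          funext i
          exact Subtype.ext Real.exp_zero
        · rintro ⟨θ, ⟨⟨ξ, y⟩, ⟨-, hy⟩, h⟩, rfl⟩
          refine ⟨y, hy, ?_⟩
          simp only [hqe _ (hKsub hy).1]
          rw [← R.q_smul ⟨fun i => ⟨Real.exp (ξ i), Real.exp_pos _⟩, 1⟩]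
          congr 1
          refine Subtype.ext ?_
          rw [coe_smul, ← flow_eq_act]
          exact h
      open_target := K.open_target
      continuousOn_toFun := (l.continuous.comp R.continuous_predBar).continuousOn
      continuousOn_invFun :=
        hqec.comp (hcont.comp_continuousOn K.continuousOn_symm)
          fun y hy => (hKsub (K.map_target hy)).1 }
  have he0 : e (R.q θ₀) = K 0 := by
    change l (S.pred θ₀) = K 0
    rw [hKA, map_zero, add_zero]
  refine ⟨e, l, fun y => (θ₀ : Param m d) + j (K.symm y), ⟨fun _ _ => rfl, ?_, ?_, ?_⟩,
    ⟨0, h0K, ?_⟩, ?_⟩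
  · exact contDiffOn_const.add (j.contDiff.comp_contDiffOn hKs)
  · exact fun y hy => (hKsub (K.map_target hy)).1
  · exact fun y hy => hqe _ _
  · simp [hqe]
  · simp only [he0, K.left_inv h0K, map_zero, add_zero]

theorem exists_isSliceChart_mem (x : R.MReg) :
    ∃ e : OpenPartialHomeomorph R.MReg (EuclideanSpace ℝ (Fin (m * d))),
      x ∈ e.source ∧ ∃ l s, R.IsSliceChart e l s := by
  obtain ⟨θ, rfl⟩ := R.isOpenQuotientMap_q.surjective x
  obtain ⟨e, l, s, h, hx, -⟩ := R.exists_isSliceChart θ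
  exact ⟨e, hx, l, s, h⟩

/-- The smooth structure of the quotient manifold, of dimension `m (d + 1) - m = m d`, given by all slice
charts. It is the one for which `q` is a smooth submersion, see `contMDiff_q` and
`mfderiv_q_surjective`. -/
instance : ChartedSpace (EuclideanSpace ℝ (Fin (m * d))) R.MReg where
  atlas := {e | ∃ l s, R.IsSliceChart e l s}
  chartAt x := (R.exists_isSliceChart_mem x).choose
  mem_chart_source x := (R.exists_isSliceChart_mem x).choose_spec.1
  chart_mem_atlas x := (R.exists_isSliceChart_mem x).choose_spec.2

instance : IsManifold (𝓡 (m * d)) ∞ R.MReg := by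
  refine isManifold_of_contDiffOn _ _ _ ?_
  rintro e e' ⟨l, s, h⟩ ⟨l', s', h'⟩
  have hc : ContDiffOn ℝ ∞ (fun y => l' (S.pred (s y))) e.target := by
    have := ContDiffOn.comp (g := S.pred) (t := R.carrier) R.smooth h.contDiffOn
      fun y hy => h.mem y hy
    exact l'.contDiff.comp_contDiffOn this
  have hsub : ∀ y, y ∈ (e.symm ≫ₕ e').source → y ∈ e.target ∧ e.symm y ∈ e'.source := by
    intro y hy
    rw [OpenPartialHomeomorph.trans_source] at hy
    exact hy
  simp only [modelWithCornersSelf_coe, modelWithCornersSelf_coe_symm, Set.range_id,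
    Set.inter_univ, Set.preimage_id, Function.id_comp, Function.comp_id]
  refine (hc.mono fun y hy => (hsub y hy).1).congr fun y hy => ?_
  change e' (e.symm y) = _
  rw [h'.apply_eq _ (hsub y hy).2, h.symm_eq y (hsub y hy).1, predBar_q]

theorem IsSliceChart.mem_maximalAtlas {R : S.RegularDomain}
    {e : OpenPartialHomeomorph R.MReg (EuclideanSpace ℝ (Fin (m * d)))} {l s}
    (h : R.IsSliceChart e l s) : e ∈ IsManifold.maximalAtlas (𝓡 (m * d)) ∞ R.MReg :=
  IsManifold.subset_maximalAtlas ⟨l, s, h⟩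

theorem contMDiff_q : ContMDiff 𝓘(ℝ, Param m d) (𝓡 (m * d)) ∞ R.q := by
  intro θ
  obtain ⟨e, l, s, h, hx, -⟩ := R.exists_isSliceChart θ
  have h₁ : ContMDiffAt 𝓘(ℝ, Param m d) (𝓡 (m * d)) ∞ (fun η : R.carrier => l (S.pred η)) θ := by
    have : ContMDiffAt 𝓘(ℝ, Param m d) (𝓡 (m * d)) ∞ (fun η => l (S.pred η)) (θ : Param m d) :=
      (l.contDiff.contDiffAt.comp _
        (R.smooth.contDiffAt (R.carrier.isOpen.mem_nhds θ.2))).contMDiffAt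
    exact this.comp θ contMDiff_subtype_val.contMDiffAt
  have hev : ∀ᶠ η in 𝓝 θ, R.q η ∈ e.source :=
    R.isOpenQuotientMap_q.continuous.continuousAt.eventually (e.open_source.mem_nhds hx)
  have h₂ : ContMDiffAt (𝓡 (m * d)) (𝓡 (m * d)) ∞ e.symm (l (S.pred θ)) := by
    have := e.map_source hx
    rw [h.apply_eq _ hx, predBar_q] at this
    exact (contMDiffOn_symm_of_mem_maximalAtlas h.mem_maximalAtlas).contMDiffAt
      (e.open_target.mem_nhds this)
  refine (h₂.comp θ h₁).congr_of_eventuallyEq ?_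
  filter_upwards [hev] with η hη
  change _ = e.symm (l (S.pred η))
  rw [← predBar_q, ← h.apply_eq _ hη, e.left_inv hη]

theorem mfderiv_q_surjective (θ : R.carrier) :
    Function.Surjective (mfderiv 𝓘(ℝ, Param m d) (𝓡 (m * d)) R.q θ) := by
  classical
  obtain ⟨e, l, s, h, hx, hs⟩ := R.exists_isSliceChart θ
  let t : R.MReg → R.carrier := fun x =>
    if hm : s (e x) ∈ R.carrier then ⟨s (e x), hm⟩ else θ
  have ht : ∀ x ∈ e.source, ((t x : R.carrier) : Param m d) = s (e x) := fun x hx' => by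
    simp [t, h.mem _ (e.map_source hx')]
  have htθ : t (R.q θ) = θ := Subtype.ext ((ht _ hx).trans hs)
  have hsrc : e.source ∈ 𝓝 (R.q θ) := e.open_source.mem_nhds hx
  have hsm : ContMDiffAt (𝓡 (m * d)) 𝓘(ℝ, Param m d) ∞ t (R.q θ) := by
    rw [← ContMDiffAt.subtypeVal_comp_iff]
    have h₁ : ContMDiffAt (𝓡 (m * d)) 𝓘(ℝ, Param m d) ∞ s (e (R.q θ)) :=
      (h.contDiffOn.contDiffAt (e.open_target.mem_nhds (e.map_source hx))).contMDiffAt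
    have h₂ : ContMDiffAt (𝓡 (m * d)) (𝓡 (m * d)) ∞ e (R.q θ) :=
      (contMDiffOn_of_mem_maximalAtlas h.mem_maximalAtlas).contMDiffAt hsrc
    refine (h₁.comp (R.q θ) h₂).congr_of_eventuallyEq ?_
    filter_upwards [hsrc] with x hx'
    exact ht x hx'
  have hid : R.q ∘ t =ᶠ[𝓝 (R.q θ)] id := by
    filter_upwards [hsrc] with x hx'
    have : t x = ⟨s (e x), h.mem _ (e.map_source hx')⟩ := Subtype.ext (ht x hx')
    rw [Function.comp_apply, this, ← h.symm_eq _ (e.map_source hx'), e.left_inv hx', id]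
  have hq : MDifferentiableAt 𝓘(ℝ, Param m d) (𝓡 (m * d)) R.q (t (R.q θ)) :=
    (R.contMDiff_q _).mdifferentiableAt (by simp)
  have hcomp := mfderiv_comp (R.q θ) hq (hsm.mdifferentiableAt (by simp))
  rw [hid.mfderiv_eq, mfderiv_id, htθ] at hcomp
  intro v
  exact ⟨_, (congrArg (fun f => f v) hcomp).symm⟩

/-- The vertical space `V_θ = T_θ(G ⬝ θ)`. -/
def vertical (θ : R.carrier) : Submodule ℝ (Param m d) := S.orbitTangent (θ : Param m d)

/-- The horizontal space `H_θ`, the Euclidean orthogonal complement of `V_θ`. -/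
def horizontal (θ : R.carrier) : Submodule ℝ (Param m d) := (R.vertical θ)ᗮ

/-- The Euclidean orthogonal projection `P_θ^hor` onto `H_θ`. -/
def horProj (θ : R.carrier) : Param m d →L[ℝ] Param m d := (R.horizontal θ).starProjection

/-- The function-induced form `g_θ(u, v) = (1 / n) ⟨DΦ_X(θ)[u], DΦ_X(θ)[v]⟩`. -/
def pullbackForm (θ : R.carrier) (u v : Param m d) : ℝ :=
  1 / (n : ℝ) * inner ℝ (fderiv ℝ S.pred (θ : Param m d) u) (fderiv ℝ S.pred (θ : Param m d) v)

/-- The differential `Dq_θ`. -/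
def dq (θ : R.carrier) : Param m d →L[ℝ] TangentSpace (𝓡 (m * d)) (R.q θ) :=
  mfderiv 𝓘(ℝ, Param m d) (𝓡 (m * d)) R.q θ

/-- The vector `u` at `θ` is a lift of the tangent vector `ξ` at `x`: `q θ = x` and `Dq_θ[u] = ξ`,
expressed as an equality in the tangent bundle of the quotient. -/
def IsLift (θ : R.carrier) (u : Param m d) (x : R.MReg) (ξ : TangentSpace (𝓡 (m * d)) x) : Prop :=
  (⟨R.q θ, R.dq θ u⟩ : TangentBundle (𝓡 (m * d)) R.MReg) = ⟨x, ξ⟩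

/-- The quotient metric: `ḡ_x(ξ, η)` is the common value of `g_θ(u^hor, v^hor)` for all `θ` in the
orbit `x` and all lifts `u`, `v` at `θ` of `ξ`, `η`. -/
def quotMetric (x : R.MReg) (ξ η : TangentSpace (𝓡 (m * d)) x) : ℝ :=
  Classical.epsilon fun r => ∃ (θ : R.carrier) (u v : Param m d),
    R.IsLift θ u x ξ ∧ R.IsLift θ v x η ∧ r = R.pullbackForm θ (R.horProj θ u) (R.horProj θ v)

/-- The loss `L = L̃ ∘ Φ_X`, on parameters. -/
def loss (_R : S.RegularDomain) (Lt : EuclideanSpace ℝ (Fin n) → ℝ) (θ : Param m d) : ℝ :=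
  Lt (S.pred θ)

/-- The descended loss on the quotient. -/
def lossBar (Lt : EuclideanSpace ℝ (Fin n) → ℝ) (x : R.MReg) : ℝ := Lt (R.predBar x)

theorem lossBar_q (Lt : EuclideanSpace ℝ (Fin n) → ℝ) (θ : R.carrier) :
    R.lossBar Lt (R.q θ) = R.loss Lt θ := rfl

/-- The defining property of the gradient of the descended loss at `x` for the quotient metric. -/
def IsQuotGrad (Lt : EuclideanSpace ℝ (Fin n) → ℝ) (x : R.MReg)
    (v : TangentSpace (𝓡 (m * d)) x) : Prop :=
  ∀ ξ : TangentSpace (𝓡 (m * d)) x,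
    R.quotMetric x v ξ = (mfderiv (𝓡 (m * d)) 𝓘(ℝ, ℝ) (R.lossBar Lt) x ξ : ℝ)

/-- The quotient gradient. -/
def quotGrad (Lt : EuclideanSpace ℝ (Fin n) → ℝ) (x : R.MReg) : TangentSpace (𝓡 (m * d)) x :=
  Classical.epsilon (R.IsQuotGrad Lt x)

/-- `u` is a horizontal lift at `θ` of the quotient gradient. -/
def IsHorLiftGrad (Lt : EuclideanSpace ℝ (Fin n) → ℝ) (θ : R.carrier) (u : Param m d) : Prop :=
  u ∈ R.horizontal θ ∧ R.dq θ u = R.quotGrad Lt (R.q θ)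

/-- The horizontal lift `u_L` of the quotient gradient. -/
def uL (Lt : EuclideanSpace ℝ (Fin n) → ℝ) (θ : R.carrier) : Param m d :=
  Classical.epsilon (R.IsHorLiftGrad Lt θ)

/-- `γ` is, on the set `J` of times, a `C¹` solution of the quotient gradient flow
`γ' = -grad L̄(γ)`. -/
def IsQuotFlow (Lt : EuclideanSpace ℝ (Fin n) → ℝ) (γ : ℝ → R.MReg) (J : Set ℝ) : Prop :=
  ContMDiffOn 𝓘(ℝ, ℝ) (𝓡 (m * d)) 1 γ J ∧
    IsMIntegralCurveOn (I := 𝓡 (m * d)) γ (fun x => -R.quotGrad Lt x) J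

/-- `θ` is, on the set `J` of times, a `C¹` solution of `θ' = -u_L(θ)`. -/
def IsHorFlow (Lt : EuclideanSpace ℝ (Fin n) → ℝ) (θ : ℝ → R.carrier) (J : Set ℝ) : Prop :=
  ContDiffOn ℝ 1 (fun t => (θ t : Param m d)) J ∧
    ∀ t ∈ J, HasDerivWithinAt (fun t => (θ t : Param m d)) (-R.uL Lt (θ t)) J t

/-- `s` restricts to a smooth local section of `q` on the open set `U`; its values outside of `U` are
irrelevant. -/
structure IsLocalSection (U : Set R.MReg) (s : R.MReg → R.carrier) : Prop where
  isOpen : IsOpen U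
  smooth : ContMDiffOn (𝓡 (m * d)) 𝓘(ℝ, Param m d) ∞ s U
  q_section : ∀ x ∈ U, R.q (s x) = x

end RegularDomain

end Model

/-- The time interval `[0, T)`, where `T = ∞` is allowed. -/
def timeInterval (T : EReal) : Set ℝ := {t | 0 ≤ t ∧ (t : EReal) < T}

end ShallowNet

end

/-! The map `Φ_X` is invariant under `G`, so it factors as `predBar ∘ q`. Differentiating gives
`DΦ_X(θ) = D predBar ∘ Dq_θ` (`dPredBar_dq`), hence `ker Dq_θ ⊆ ker DΦ_X(θ) = V_θ`; both ends have
dimension `m`, so `ker Dq_θ = V_θ` (`ker_dq`). Two things follow. First, `Dq_θ` restricts to an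
isomorphism from `H_θ` onto the tangent space of the quotient, so horizontal lifts exist and are
unique. Second, `D predBar` is injective (`dPredBar_injective`).

The quotient metric is then the pullback of `(1/n)⟨·,·⟩` by `D predBar` (`quotMetric_eq`), a formula
in which neither `θ` nor any lift occurs. It is nondegenerate by injectivity, so the gradient exists
and is unique (`existsUnique_represents`), and the variational equation for `u_L` is the gradient
equation tested on horizontal vectors.

The statements on flows are the chain rule. Since `q ∘ s ∘ γ = γ`, the velocity of the lifted curve
lies over that of `γ`; its horizontal part has the same image under `Dq`, so it is the horizontal
lift of `-grad`. In the other direction, `Dq` sends `-u_L` to `-grad`. -/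

noncomputable section

namespace ShallowNet
open TopologicalSpace

/-! ### Calculus on an open subset of a vector space. -/

section Opens

variable {E : Type*} [NormedAddCommGroup E] [NormedSpace ℝ E]

/-- The inclusion of an open subset of a vector space has the identity as its derivative. -/
theorem hasMFDerivAt_opens_coe {O : Opens E} (x : O) :
    HasMFDerivAt 𝓘(ℝ, E) 𝓘(ℝ, E) (Subtype.val : O → E) x (ContinuousLinearMap.id ℝ E) := by
  refine ⟨continuous_subtype_val.continuousAt, ?_⟩
  -- The inverse chart of `O` is the identity only near `x`, so the chart expression of the
  -- inclusion is compared with `id` as a germ.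
  have h : (id : E → E) =ᶠ[𝓝 (x : E)] Subtype.val ∘ (chartAt E x).symm :=
    Opens.chartAt_subtype_val_symm_eventuallyEq O
  have hid : HasFDerivWithinAt (id : E → E) (ContinuousLinearMap.id ℝ E) Set.univ (x : E) :=
    hasFDerivWithinAt_id _ _
  simp only [writtenInExtChartAt, mfld_simps]
  refine hid.congr_of_eventuallyEq ?_ ?_
  · rw [nhdsWithin_univ]
    exact h.symm
  · exact h.self_of_nhds.symm

/-- A curve in an open subset of a vector space is differentiable as a curve in the manifold if it is
as a curve in the vector space. -/
theorem hasMFDerivWithinAt_opens {O : Opens E} {θ : ℝ → O} {J : Set ℝ} {t : ℝ} {v : E}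
    (h : HasDerivWithinAt (fun t => (θ t : E)) v J t) :
    HasMFDerivWithinAt 𝓘(ℝ, ℝ) 𝓘(ℝ, E) θ J t ((1 : ℝ →L[ℝ] ℝ).smulRight v) := by
  refine ⟨Topology.IsEmbedding.subtypeVal.isInducing.continuousWithinAt_iff.2
    h.continuousWithinAt, ?_⟩
  have h' := h.hasFDerivWithinAt
  simp only [writtenInExtChartAt, mfld_simps]
  exact h'

end Opens

/-! ### Linear algebra: representing functionals, velocities as linear maps on `ℝ`. -/

/-- A form pulled back from an inner product by an injective linear map represents every linear
functional. -/
theorem existsUnique_represents {E F : Type*} [AddCommGroup E] [Module ℝ E] [FiniteDimensional ℝ E]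
    [NormedAddCommGroup F] [InnerProductSpace ℝ F] {D : E →ₗ[ℝ] F} (hD : Function.Injective D)
    {c : ℝ} (hc : c ≠ 0 ∨ Subsingleton F) (ℓ : E →ₗ[ℝ] ℝ) :
    ∃! v, ∀ ξ, c * inner ℝ (D v) (D ξ) = ℓ ξ := by
  let B : E →ₗ[ℝ] Module.Dual ℝ E := c • (innerₗ F).compl₁₂ D D
  have hB : ∀ v ξ, B v ξ = c * inner ℝ (D v) (D ξ) := fun v ξ => rfl
  have hinj : Function.Injective B := by
    rw [← LinearMap.ker_eq_bot, LinearMap.ker_eq_bot']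
    intro v hv
    apply hD
    rw [map_zero]
    -- Setting `ξ = v` gives `c‖D v‖² = 0`. When `c = 0` is allowed, `F` is trivial and `D v = 0`
    -- without computation.
    rcases hc with hc | hF
    · have := hB v v
      rw [hv, LinearMap.zero_apply, eq_comm, mul_eq_zero] at this
      exact inner_self_eq_zero.1 (this.resolve_left hc)
    · exact Subsingleton.elim _ _
  have hsurj : Function.Surjective B :=
    (LinearMap.injective_iff_surjective_of_finrank_eq_finrank
      Subspace.dual_finrank_eq.symm).1 hinj
  obtain ⟨v, hv⟩ := hsurj ℓ
  refine ⟨v, fun ξ => by rw [← hB, hv], fun w hw => hinj ?_⟩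
  rw [hv]
  ext ξ
  rw [hB, hw]

theorem _root_.ContinuousLinearMap.comp_smulRight_one {E F : Type*} [AddCommGroup E]
    [Module ℝ E] [TopologicalSpace E] [ContinuousSMul ℝ E] [AddCommGroup F] [Module ℝ F]
    [TopologicalSpace F] [ContinuousSMul ℝ F] (A : E →L[ℝ] F) (v : E) :
    A.comp ((1 : ℝ →L[ℝ] ℝ).smulRight v) = (1 : ℝ →L[ℝ] ℝ).smulRight (A v) := by
  ext
  simp

theorem _root_.ContinuousLinearMap.eq_of_smulRight_one_eq {E : Type*} [AddCommGroup E]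
    [Module ℝ E] [TopologicalSpace E] [ContinuousSMul ℝ E] {v w : E}
    (h : (1 : ℝ →L[ℝ] ℝ).smulRight v = (1 : ℝ →L[ℝ] ℝ).smulRight w) : v = w := by
  simpa using congrArg (fun f => f 1) h

/-! ### The differentials of `q` and of the induced prediction map. -/

namespace Model.RegularDomain

variable {m d n : ℕ} {S : Model m d n} (R : S.RegularDomain)

theorem differentiableAt_pred (θ : R.carrier) : DifferentiableAt ℝ S.pred (θ : Param m d) :=
  (R.smooth.contDiffAt (R.carrier.isOpen.mem_nhds θ.2)).differentiableAt (by simp)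

/-- In a slice chart with slice `s`, the induced map is `S.pred ∘ s`, a composition of smooth maps.
-/
theorem mdifferentiableAt_predBar (x : R.MReg) :
    MDifferentiableAt (𝓡 (m * d)) 𝓘(ℝ, EuclideanSpace ℝ (Fin n)) R.predBar x := by
  obtain ⟨e, hx, l, s, h⟩ := R.exists_isSliceChart_mem x
  have h₁ : MDifferentiableAt (𝓡 (m * d)) (𝓡 (m * d)) e x :=
    ((contMDiffOn_of_mem_maximalAtlas h.mem_maximalAtlas).contMDiffAt
      (e.open_source.mem_nhds hx)).mdifferentiableAt (by simp)
  have h₂ : DifferentiableAt ℝ (fun y => S.pred (s y)) (e x) :=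
    ((ContDiffOn.comp (g := S.pred) (t := R.carrier) R.smooth h.contDiffOn
      fun y hy => h.mem y hy).contDiffAt
        (e.open_target.mem_nhds (e.map_source hx))).differentiableAt (by simp)
  refine (h₂.mdifferentiableAt.comp x h₁).congr_of_eventuallyEq ?_
  filter_upwards [e.open_source.mem_nhds hx] with y hy
  change _ = S.pred (s (e y))
  conv_lhs => rw [← e.left_inv hy, h.symm_eq _ (e.map_source hy), predBar_q]

/-- The differential of the map induced by `Φ_X` on the quotient. -/
def dPredBar (x : R.MReg) : TangentSpace (𝓡 (m * d)) x →L[ℝ] EuclideanSpace ℝ (Fin n) :=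
  mfderiv (𝓡 (m * d)) 𝓘(ℝ, EuclideanSpace ℝ (Fin n)) R.predBar x

theorem hasMFDerivAt_q (θ : R.carrier) :
    HasMFDerivAt 𝓘(ℝ, Param m d) (𝓡 (m * d)) R.q θ (R.dq θ) :=
  ((R.contMDiff_q θ).mdifferentiableAt (by simp)).hasMFDerivAt

/-- The chain rule on the two sides of `predBar ∘ q = Φ_X ∘ (inclusion of Θ_reg)`, followed by
uniqueness of the derivative. -/
theorem dPredBar_dq (θ : R.carrier) (u : Param m d) :
    R.dPredBar (R.q θ) (R.dq θ u) = fderiv ℝ S.pred (θ : Param m d) u := by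
  have h₁ := (R.mdifferentiableAt_predBar (R.q θ)).hasMFDerivAt.comp θ (R.hasMFDerivAt_q θ)
  have h₂ := (R.differentiableAt_pred θ).hasFDerivAt.hasMFDerivAt.comp θ
    (hasMFDerivAt_opens_coe θ)
  exact congrArg (fun f => f u) (hasMFDerivAt_unique h₁ h₂)

theorem mem_vertical_iff (θ : R.carrier) (u : Param m d) :
    u ∈ R.vertical θ ↔ fderiv ℝ S.pred (θ : Param m d) u = 0 := by
  rw [vertical, ← R.ker_eq θ θ.2]
  rfl

/-- The vertical space is the kernel of `Dq_θ`. -/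
theorem ker_dq (θ : R.carrier) : LinearMap.ker (R.dq θ).toLinearMap = R.vertical θ := by
  refine Submodule.eq_of_le_of_finrank_eq (fun u hu => ?_) ?_
  · rw [mem_vertical_iff, ← dPredBar_dq]
    rw [LinearMap.mem_ker] at hu
    exact (congrArg _ hu).trans (map_zero _)
  -- Rank-nullity: `Dq_θ` maps dimension `m d + m` onto dimension `m d`, so its kernel has dimension
  -- `m`, as does the orbit tangent space by local freeness. The tangent space is unfolded to its
  -- model to make its dimension visible.
  · let f : Param m d →ₗ[ℝ] EuclideanSpace ℝ (Fin (m * d)) := (R.dq θ).toLinearMap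
    have hf : LinearMap.range f = ⊤ := LinearMap.range_eq_top.2 (R.mfderiv_q_surjective θ)
    have h₁ := f.finrank_range_add_finrank_ker
    rw [hf, finrank_top, finrank_param, finrank_euclideanSpace_fin] at h₁
    have h₂ := finrank_orbitTangent (R.locallyFree θ θ.2)
    change Module.finrank ℝ (LinearMap.ker f) = Module.finrank ℝ (S.orbitTangent θ)
    omega

theorem dq_eq_zero_iff (θ : R.carrier) (u : Param m d) : R.dq θ u = 0 ↔ u ∈ R.vertical θ := by
  rw [← ker_dq]
  rfl

theorem sub_horProj_mem (θ : R.carrier) (u : Param m d) : u - R.horProj θ u ∈ R.vertical θ := by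
  have := (R.horizontal θ).sub_starProjection_mem_orthogonal u
  rwa [horizontal, Submodule.orthogonal_orthogonal] at this

theorem horProj_mem (θ : R.carrier) (u : Param m d) : R.horProj θ u ∈ R.horizontal θ :=
  Submodule.starProjection_apply_mem _ _

theorem dq_horProj (θ : R.carrier) (u : Param m d) : R.dq θ (R.horProj θ u) = R.dq θ u := by
  have := (R.dq_eq_zero_iff θ _).2 (R.sub_horProj_mem θ u)
  rw [map_sub, sub_eq_zero] at this
  exact this.symm

/-- Horizontal vectors are determined by their image under `Dq_θ`. -/
theorem eq_of_dq_eq {θ : R.carrier} {u v : Param m d} (hu : u ∈ R.horizontal θ)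
    (hv : v ∈ R.horizontal θ) (h : R.dq θ u = R.dq θ v) : u = v := by
  have h₁ : u - v ∈ R.vertical θ := by rw [← dq_eq_zero_iff, map_sub, h, sub_self]
  exact sub_eq_zero.1 <| Submodule.disjoint_def.1
    (Submodule.orthogonal_disjoint (R.vertical θ)) _ h₁ (sub_mem hu hv)

theorem exists_horizontal (θ : R.carrier) (ξ : TangentSpace (𝓡 (m * d)) (R.q θ)) :
    ∃ u ∈ R.horizontal θ, R.dq θ u = ξ := by
  obtain ⟨u, hu⟩ := R.mfderiv_q_surjective θ ξ
  exact ⟨_, R.horProj_mem θ u, (R.dq_horProj θ u).trans hu⟩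

/-- This is where nondegeneracy of the quotient metric comes from: a lift of a vector killed by `D
predBar` is killed by `DΦ_X`, hence vertical, hence killed by `Dq`. -/
theorem dPredBar_injective (x : R.MReg) : Function.Injective (R.dPredBar x) := by
  obtain ⟨θ, rfl⟩ := R.isOpenQuotientMap_q.surjective x
  rw [injective_iff_map_eq_zero]
  intro ξ hξ
  obtain ⟨u, -, rfl⟩ := R.exists_horizontal θ ξ
  rwa [dPredBar_dq, ← mem_vertical_iff, ← dq_eq_zero_iff] at hξ

/-! ### The quotient metric, its gradient and the horizontal lift. -/

theorem pullbackForm_eq (θ : R.carrier) (u v : Param m d) :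
    R.pullbackForm θ u v = 1 / (n : ℝ) *
      inner ℝ (R.dPredBar (R.q θ) (R.dq θ u)) (R.dPredBar (R.q θ) (R.dq θ v)) := by
  rw [dPredBar_dq, dPredBar_dq, pullbackForm]

theorem isLift_q (θ : R.carrier) (u : Param m d) (ξ : TangentSpace (𝓡 (m * d)) (R.q θ)) :
    R.IsLift θ u (R.q θ) ξ ↔ R.dq θ u = ξ := by
  simp [IsLift]

/-- The quotient metric is the pullback of the normalized inner product by the differential of the map
induced by `Φ_X`. -/
theorem quotMetric_eq (x : R.MReg) (ξ η : TangentSpace (𝓡 (m * d)) x) :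
    R.quotMetric x ξ η = 1 / (n : ℝ) * inner ℝ (R.dPredBar x ξ) (R.dPredBar x η) := by
  -- Every admissible choice of `θ`, `u`, `v` gives the same value, so the choice made by `epsilon`
  -- is harmless. The point `x` is quantified again so that it can be replaced by `q θ`.
  have key : ∀ (θ : R.carrier) (u v : Param m d) (x : R.MReg) (ξ η : TangentSpace (𝓡 (m * d)) x),
      R.IsLift θ u x ξ → R.IsLift θ v x η → R.pullbackForm θ (R.horProj θ u) (R.horProj θ v) =
        1 / (n : ℝ) * inner ℝ (R.dPredBar x ξ) (R.dPredBar x η) := by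
    intro θ u v x ξ η hu hv
    obtain rfl : R.q θ = x := congrArg Bundle.TotalSpace.proj hu
    rw [isLift_q] at hu hv
    rw [pullbackForm_eq, dq_horProj, dq_horProj, hu, hv]
  have hex : ∃ r, ∃ (θ : R.carrier) (u v : Param m d), R.IsLift θ u x ξ ∧ R.IsLift θ v x η ∧
      r = R.pullbackForm θ (R.horProj θ u) (R.horProj θ v) := by
    obtain ⟨θ, rfl⟩ := R.isOpenQuotientMap_q.surjective x
    obtain ⟨u, -, hu⟩ := R.exists_horizontal θ ξ
    obtain ⟨v, -, hv⟩ := R.exists_horizontal θ η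
    exact ⟨_, θ, u, v, (R.isLift_q θ u ξ).2 hu, (R.isLift_q θ v η).2 hv, rfl⟩
  obtain ⟨θ, u, v, hu, hv, h⟩ := Classical.epsilon_spec hex
  exact h.trans (key θ u v x ξ η hu hv)

theorem quotMetric_dq (θ : R.carrier) (u v : Param m d) :
    R.quotMetric (R.q θ) (R.dq θ u) (R.dq θ v) = R.pullbackForm θ u v := by
  rw [quotMetric_eq, pullbackForm_eq]

variable (Lt : EuclideanSpace ℝ (Fin n) → ℝ)

theorem existsUnique_isQuotGrad (x : R.MReg) : ∃! v, R.IsQuotGrad Lt x v := by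
  -- For `n = 0` the factor `1 / n` is `0` by convention, but then `ℝ^n` is trivial.
  have hc : 1 / (n : ℝ) ≠ 0 ∨ Subsingleton (EuclideanSpace ℝ (Fin n)) := by
    rcases Nat.eq_zero_or_pos n with rfl | hn
    · exact Or.inr inferInstance
    · exact Or.inl (by positivity)
  have : FiniteDimensional ℝ (TangentSpace (𝓡 (m * d)) x) :=
    inferInstanceAs (FiniteDimensional ℝ (EuclideanSpace ℝ (Fin (m * d))))
  have := existsUnique_represents (D := (R.dPredBar x).toLinearMap) (R.dPredBar_injective x) hc
    (mfderiv (𝓡 (m * d)) 𝓘(ℝ, ℝ) (R.lossBar Lt) x).toLinearMap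
  simp only [IsQuotGrad, quotMetric_eq]
  exact this

theorem isQuotGrad_iff (x : R.MReg) (v : TangentSpace (𝓡 (m * d)) x) :
    R.IsQuotGrad Lt x v ↔ v = R.quotGrad Lt x := by
  have h := R.existsUnique_isQuotGrad Lt x
  have hs : R.IsQuotGrad Lt x (R.quotGrad Lt x) := Classical.epsilon_spec h.exists
  exact ⟨fun hv => h.unique hv hs, fun hv => hv ▸ hs⟩

theorem isHorLiftGrad_iff (θ : R.carrier) (u : Param m d) :
    R.IsHorLiftGrad Lt θ u ↔ u = R.uL Lt θ := by
  have hs : R.IsHorLiftGrad Lt θ (R.uL Lt θ) :=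
    Classical.epsilon_spec (R.exists_horizontal θ (R.quotGrad Lt (R.q θ)))
  exact ⟨fun hu => R.eq_of_dq_eq hu.1 hs.1 (hu.2.trans hs.2.symm), fun hu => hu ▸ hs⟩

variable {Lt}

theorem dq_uL (θ : R.carrier) : R.dq θ (R.uL Lt θ) = R.quotGrad Lt (R.q θ) :=
  ((R.isHorLiftGrad_iff Lt θ _).2 rfl).2

/-- Both sides are `DL̃` applied to `DΦ_X(θ)[v]`. -/
theorem mfderiv_lossBar_dq (hLt : Differentiable ℝ Lt) (θ : R.carrier) (v : Param m d) :
    mfderiv (𝓡 (m * d)) 𝓘(ℝ, ℝ) (R.lossBar Lt) (R.q θ) (R.dq θ v) =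
      fderiv ℝ (R.loss Lt) (θ : Param m d) v := by
  have h₁ := (hLt (R.predBar (R.q θ))).hasFDerivAt.hasMFDerivAt.comp _
    (R.mdifferentiableAt_predBar (R.q θ)).hasMFDerivAt
  have h₂ := ((hLt (S.pred θ)).hasFDerivAt.comp (θ : Param m d)
    (R.differentiableAt_pred θ).hasFDerivAt).fderiv
  have h₃ := h₁.mfderiv
  have h₄ : mfderiv (𝓡 (m * d)) 𝓘(ℝ, ℝ) (R.lossBar Lt) (R.q θ) (R.dq θ v) =
      fderiv ℝ Lt (S.pred θ) (R.dPredBar (R.q θ) (R.dq θ v)) :=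
    congrArg (fun f => f (R.dq θ v)) h₃
  rw [dPredBar_dq] at h₄
  exact h₄.trans (congrArg (fun f => f v) h₂).symm

/-- Testing on horizontal `v` is enough, because `Dq_θ` maps `H_θ` onto the whole tangent space of
the quotient. -/
theorem dq_eq_quotGrad_iff (hLt : Differentiable ℝ Lt) (θ : R.carrier) (u : Param m d) :
    R.dq θ u = R.quotGrad Lt (R.q θ) ↔
      ∀ v ∈ R.horizontal θ, R.pullbackForm θ u v = fderiv ℝ (R.loss Lt) θ v := by
  rw [← isQuotGrad_iff]
  constructor
  · intro h v _
    rw [← quotMetric_dq, h, R.mfderiv_lossBar_dq hLt]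
  · intro h ξ
    obtain ⟨v, hv, rfl⟩ := R.exists_horizontal θ ξ
    rw [quotMetric_dq, h v hv, R.mfderiv_lossBar_dq hLt]

/-! ### Projecting and lifting flows. -/

theorem hasMFDerivWithinAt_q_comp {θ : ℝ → R.carrier} {J : Set ℝ} {t : ℝ} {v : Param m d}
    (h : HasDerivWithinAt (fun t => (θ t : Param m d)) v J t) :
    HasMFDerivWithinAt 𝓘(ℝ, ℝ) (𝓡 (m * d)) (fun t => R.q (θ t)) J t
      ((1 : ℝ →L[ℝ] ℝ).smulRight (R.dq (θ t) v)) := by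
  refine ((R.hasMFDerivAt_q (θ t)).comp_hasMFDerivWithinAt t
    (hasMFDerivWithinAt_opens h)).congr_mfderiv ?_
  exact ContinuousLinearMap.comp_smulRight_one (R.dq (θ t)) v

theorem isQuotFlow_of_isHorFlow {θ : ℝ → R.carrier} {J : Set ℝ} (h : R.IsHorFlow Lt θ J) :
    R.IsQuotFlow Lt (fun t => R.q (θ t)) J := by
  refine ⟨?_, fun t ht => ?_⟩
  · have h₁ : ContMDiffOn 𝓘(ℝ, ℝ) 𝓘(ℝ, Param m d) 1 θ J := fun t ht =>
      (ChartedSpace.liftPropWithinAt_subtypeVal_comp_iff ..).1 (h.1.contMDiffOn t ht)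
    exact (R.contMDiff_q.of_le (by simp)).comp_contMDiffOn h₁
  · refine (R.hasMFDerivWithinAt_q_comp (h.2 t ht)).congr_mfderiv ?_
    rw [map_neg, dq_uL]

theorem IsLocalSection.lift_isQuotFlow {R : S.RegularDomain} {U : Set R.MReg}
    {s : R.MReg → R.carrier} (hs : R.IsLocalSection U s) {γ : ℝ → R.MReg} {J : Set ℝ}
    (hγ : R.IsQuotFlow Lt γ J) (hJ : UniqueDiffOn ℝ J) (hU : Set.MapsTo γ J U) :
    ContDiffOn ℝ 1 (fun t => (s (γ t) : Param m d)) J ∧ ∀ t ∈ J,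
      R.IsLift (s (γ t)) (derivWithin (fun t => (s (γ t) : Param m d)) J t)
        (γ t) (-R.quotGrad Lt (γ t)) ∧
      R.horProj (s (γ t)) (derivWithin (fun t => (s (γ t) : Param m d)) J t) =
        -R.uL Lt (s (γ t)) := by
  have hC : ContDiffOn ℝ 1 (fun t => (s (γ t) : Param m d)) J := by
    rw [← contMDiffOn_iff_contDiffOn]
    exact contMDiff_subtype_val.comp_contMDiffOn
      ((hs.smooth.of_le (by simp)).comp hγ.1 hU)
  refine ⟨hC, fun t ht => ?_⟩
  have hq : R.q (s (γ t)) = γ t := hs.q_section _ (hU ht)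
  have hd := R.hasMFDerivWithinAt_q_comp
    ((hC.differentiableOn (by simp)) t ht).hasDerivWithinAt
  -- On `J` the curve `q ∘ s ∘ γ` is `γ`, so `γ` has two derivatives within `J`; unique
  -- differentiability of `J` makes them agree.
  have hd' := hd.congr_mono (fun r hr => (hs.q_section _ (hU hr)).symm) hq.symm subset_rfl
  -- The tangent spaces at `q (s (γ t))` and at `γ t` are the same only through `hq`; both unfold to
  -- the model space, where the equality can be stated.
  have heq : R.dq (s (γ t)) (derivWithin (fun t => (s (γ t) : Param m d)) J t) =
      (-R.quotGrad Lt (γ t) : EuclideanSpace ℝ (Fin (m * d))) := by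
    exact ContinuousLinearMap.eq_of_smulRight_one_eq
      (E := EuclideanSpace ℝ (Fin (m * d)))
      ((hJ t ht).uniqueMDiffWithinAt.eq hd' (hγ.2 t ht))
  have hlift : R.IsLift (s (γ t)) (derivWithin (fun t => (s (γ t) : Param m d)) J t)
      (γ t) (-R.quotGrad Lt (γ t)) :=
    Bundle.TotalSpace.ext hq (heq_of_eq heq)
  refine ⟨hlift, ?_⟩
  have hgrad : R.quotGrad Lt (R.q (s (γ t))) =
      (R.quotGrad Lt (γ t) : EuclideanSpace ℝ (Fin (m * d))) := by rw [hq]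
  -- The sign is moved onto the velocity because `uL` is characterized as the lift of `+grad`.
  have hneg : R.dq (s (γ t)) (-derivWithin (fun t => (s (γ t) : Param m d)) J t) =
      R.quotGrad Lt (R.q (s (γ t))) := by
    rw [map_neg, neg_eq_iff_eq_neg]
    exact heq.trans (congrArg Neg.neg hgrad.symm)
  rw [← neg_eq_iff_eq_neg, ← map_neg, ← isHorLiftGrad_iff]
  exact ⟨R.horProj_mem _ _, (R.dq_horProj _ _).trans hneg⟩

end Model.RegularDomain
end ShallowNet

end

/-- Since `Dq_θ` maps `H_θ` onto the tangent space, the first clause determines `quotMetric`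
completely. Values `T ≤ 0` are harmless: the time interval is then empty. -/
theorem mainTheorem3 {m d n : ℕ} (S : ShallowNet.Model m d n) (R : S.RegularDomain)
    [ProperSMul (ShallowNet.SymGroup m) R.carrier]
    (Lt : EuclideanSpace ℝ (Fin n) → ℝ) (hLt : ContDiff ℝ ∞ Lt) :
    -- the quotient metric is well defined by the form on horizontal vectors
    (∀ θ : R.carrier, ∀ u ∈ R.horizontal θ, ∀ v ∈ R.horizontal θ,
      R.quotMetric (R.q θ) (R.dq θ u) (R.dq θ v) = R.pullbackForm θ u v) ∧
    -- the quotient gradient exists and is unique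
    (∀ (x : R.MReg) (v : TangentSpace (𝓡 (m * d)) x),
      R.IsQuotGrad Lt x v ↔ v = R.quotGrad Lt x) ∧
    -- its horizontal lift exists and is unique
    (∀ (θ : R.carrier) (u : ShallowNet.Param m d), R.IsHorLiftGrad Lt θ u ↔ u = R.uL Lt θ) ∧
    -- equivalent variational characterization of the horizontal lift
    (∀ (θ : R.carrier), ∀ u ∈ R.horizontal θ,
      R.dq θ u = R.quotGrad Lt (R.q θ) ↔
        ∀ v ∈ R.horizontal θ, R.pullbackForm θ u v = fderiv ℝ (R.loss Lt) θ v) ∧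
    -- lifting a solution of the quotient gradient flow through a local section
    (∀ (T : EReal) (γ : ℝ → R.MReg), R.IsQuotFlow Lt γ (ShallowNet.timeInterval T) →
      ∀ (U : Set R.MReg) (s : R.MReg → R.carrier), R.IsLocalSection U s →
      ∀ T₀ : ℝ, 0 < T₀ → (T₀ : EReal) < T → γ '' Set.Icc 0 T₀ ⊆ U →
        ContDiffOn ℝ 1 (fun t => (s (γ t) : ShallowNet.Param m d)) (Set.Icc 0 T₀) ∧
        ∀ t ∈ Set.Icc 0 T₀,
          R.IsLift (s (γ t))
            (derivWithin (fun t => (s (γ t) : ShallowNet.Param m d)) (Set.Icc 0 T₀) t)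
            (γ t) (-R.quotGrad Lt (γ t)) ∧
          R.horProj (s (γ t))
            (derivWithin (fun t => (s (γ t) : ShallowNet.Param m d)) (Set.Icc 0 T₀) t) =
              -R.uL Lt (s (γ t))) ∧
    -- projecting a solution of the horizontal flow
    (∀ (T : EReal) (θ : ℝ → R.carrier), R.IsHorFlow Lt θ (ShallowNet.timeInterval T) →
      R.IsQuotFlow Lt (fun t => R.q (θ t)) (ShallowNet.timeInterval T)) := by
  refine ⟨fun θ u _ v _ => R.quotMetric_dq θ u v, R.isQuotGrad_iff Lt, R.isHorLiftGrad_iff Lt,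
    fun θ u _ => R.dq_eq_quotGrad_iff (hLt.differentiable (by simp)) θ u, ?_,
    fun T θ h => R.isQuotFlow_of_isHorFlow h⟩
  intro T γ hγ U s hs T₀ hT₀ hT hU
  have hsub : Set.Icc 0 T₀ ⊆ ShallowNet.timeInterval T := fun t ht =>
    ⟨ht.1, (EReal.coe_le_coe_iff.2 ht.2).trans_lt hT⟩
  -- Positivity of `T₀` makes `[0, T₀]` nondegenerate, so one-sided derivatives at its endpoints are
  -- unique.
  exact hs.lift_isQuotFlow ⟨hγ.1.mono hsub, fun t ht => (hγ.2 t (hsub ht)).mono hsub⟩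
    (uniqueDiffOn_Icc hT₀) (Set.mapsTo_iff_image_subset.2 hU)
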